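/- **Proposition 3.1.** Let $(M,g)$ be a spacetime: a connected Hausdorff second countable smooth manifold with a smooth Lorentzian metric of signature $(-,+,\dots,+)$ and a time orientation. Curves are piecewise smooth; a timelike (causal) curve is taken future-directed. Write $p\ll q$ if there is a timelike curve from $p$ to $q$, and $I^-(A)=\{p: p\ll q\text{ for some }q\in A\}$. The Lorentzian distance $d(p,q)\in[0,\infty]$ is the supremum of the Lorentzian lengths $L=\int\sqrt{-g(\gamma',\gamma')}$ of the causal curves from $p$ to $q$ ($0$ if there are none). A curve $\gamma:[0,b)\to M$, $0<b\le\infty$, is future-inextendible if it has no future endpoint, i.e. $\gamma(t)$ does not converge in $M$ as $t\to b$. Suppose that $(M,g)$ is chronological ($p\ll p$ for no $p$) and has a single TIP, in at least one of the following two senses (which agree by the Geroch–Kronheimer–Penrose theorem if $M$ is strongly causal): 1. there is exactly one subset of $M$ of the form $I^-(\gamma)$ with $\gamma$ a future-inextendible timelike curve; or 2. $(M,g)$ is strongly causal (each point has arbitrarily small open neighbourhoods that no causal curve meets in a disconnected set), and there is exactly one terminal indecomposable past set, i.e. exactly one non-empty set $W=I^-(W)$ that is not the union of two proper subsets $A=I^-(A)$,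 $B=I^-(B)$ and is not of the form $I^-(\{p\})$ with $p\in M$. Suppose further that $(M,g)$ admits a future incomplete timelike ray, i.e. a future-inextendible timelike curve $\gamma:[0,a)\to M$ with $L(\gamma|_{[s,t]})=d(\gamma(s),\gamma(t))$ for all $0\le s<t<a$ and with finite total length (proper time) $L(\gamma)<\infty$. Then every timelike geodesic in $M$ is future incomplete: no affinely parametrized future-directed timelike geodesic $\delta:[0,b)\to M$ extends to a geodesic defined for all affine parameters in $[0,\infty)$. -/

import Mathlib

open Set Topology MeasureTheory
open scoped Manifold ContDiff ENNReal

noncomputable section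

/-- The expression in the chart around `x₀` of a field `g` of bilinear forms on the tangent spaces:
at a point `y` of the chart's target this is the matrix `(g_ij (y))`, as a bilinear form. -/
def chartMetric {n : ℕ} {M : Type*} [TopologicalSpace M] [ChartedSpace (EuclideanSpace ℝ (Fin n)) M]
    (g : ∀ x : M, TangentSpace (𝓡 n) x →L[ℝ] TangentSpace (𝓡 n) x →L[ℝ] ℝ) (x₀ : M)
    (y : EuclideanSpace ℝ (Fin n)) :
    EuclideanSpace ℝ (Fin n) →L[ℝ] EuclideanSpace ℝ (Fin n) →L[ℝ] ℝ :=
  let A : EuclideanSpace ℝ (Fin n) →L[ℝ] TangentSpace (𝓡 n) ((extChartAt (𝓡 n) x₀).symm y) :=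
    mfderiv 𝓘(ℝ, EuclideanSpace ℝ (Fin n)) (𝓡 n) (extChartAt (𝓡 n) x₀).symm y
  ((A.precomp ℝ).comp (g ((extChartAt (𝓡 n) x₀).symm y))).comp A

/-- A smooth Lorentzian metric of signature `(-,+,…,+)` on `M` together with a time orientation,
given by a continuous timelike vector field. -/
structure Spacetime (n : ℕ) (M : Type*) [TopologicalSpace M]
    [ChartedSpace (EuclideanSpace ℝ (Fin n)) M] [IsManifold (𝓡 n) ∞ M] where
  /-- the metric -/
  g : ∀ x : M, TangentSpace (𝓡 n) x →L[ℝ] TangentSpace (𝓡 n) x →L[ℝ] ℝ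
  symm : ∀ x v w, g x v w = g x w v
  /-- some vector is timelike, and `g` is positive definite on its orthogonal complement -/
  lorentzian : ∀ x, ∃ v, g x v v < 0 ∧ ∀ w, g x v w = 0 → w ≠ 0 → 0 < g x w w
  smooth : ∀ x₀ : M, ContDiffOn ℝ ∞ (chartMetric g x₀) (extChartAt (𝓡 n) x₀).target
  /-- the vector field that defines the time orientation -/
  timeField : ∀ x : M, TangentSpace (𝓡 n) x
  timeField_timelike : ∀ x, g x (timeField x) (timeField x) < 0
  timeField_continuous : Continuous fun x => (⟨x, timeField x⟩ : TangentBundle (𝓡 n) M)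

namespace Spacetime

variable {n : ℕ} {M : Type*} [TopologicalSpace M] [ChartedSpace (EuclideanSpace ℝ (Fin n)) M]
  [IsManifold (𝓡 n) ∞ M] (S : Spacetime n M)

/-- A future-directed timelike tangent vector. -/
def FutureTimelike {x : M} (v : TangentSpace (𝓡 n) x) : Prop :=
  S.g x v v < 0 ∧ S.g x (S.timeField x) v < 0

/-- A future-directed causal (non-spacelike, non-zero) tangent vector. -/
def FutureCausal {x : M} (v : TangentSpace (𝓡 n) x) : Prop :=
  S.g x v v ≤ 0 ∧ S.g x (S.timeField x) v < 0

/-- The velocity at `t` of a curve with domain `s` (one-sided at an end point of the domain). -/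
def velocity (n : ℕ) {M : Type*} [TopologicalSpace M] [ChartedSpace (EuclideanSpace ℝ (Fin n)) M]
    (γ : ℝ → M) (s : Set ℝ) (t : ℝ) : TangentSpace (𝓡 n) (γ t) :=
  mfderivWithin 𝓘(ℝ, ℝ) (𝓡 n) γ s t (1 : ℝ)

/-- `S.TimelikeCurve γ a b`: restricted to `[a, b]`, `a < b`, the curve `γ` is piecewise smooth,
future-directed and timelike (including both one-sided velocities at a break point): it is a finite
concatenation of smooth future-directed timelike pieces. -/
inductive TimelikeCurve (γ : ℝ → M) : ℝ → ℝ → Prop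
  | piece {a b : ℝ} : a < b → ContMDiffOn 𝓘(ℝ, ℝ) (𝓡 n) ∞ γ (Icc a b) →
      (∀ t ∈ Icc a b, S.FutureTimelike (velocity n γ (Icc a b) t)) → TimelikeCurve γ a b
  | concat {a b c : ℝ} : TimelikeCurve γ a b → TimelikeCurve γ b c → TimelikeCurve γ a c

/-- The same with "causal" in place of "timelike". -/
inductive CausalCurve (γ : ℝ → M) : ℝ → ℝ → Prop
  | piece {a b : ℝ} : a < b → ContMDiffOn 𝓘(ℝ, ℝ) (𝓡 n) ∞ γ (Icc a b) →
      (∀ t ∈ Icc a b, S.FutureCausal (velocity n γ (Icc a b) t)) → CausalCurve γ a b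
  | concat {a b c : ℝ} : CausalCurve γ a b → CausalCurve γ b c → CausalCurve γ a c

/-- The chronology relation `p ≪ q`. -/
def Chron (p q : M) : Prop :=
  ∃ (γ : ℝ → M) (a b : ℝ), S.TimelikeCurve γ a b ∧ γ a = p ∧ γ b = q

/-- The chronological past `I⁻(A)` of a set. -/
def chronPast (A : Set M) : Set M := {p | ∃ q ∈ A, S.Chron p q}

/-- There are no closed timelike curves. -/
def Chronological : Prop := ∀ p : M, ¬ S.Chron p p

/-- The Lorentzian length `∫ √(-g(γ', γ'))` of the part of `γ` over the parameters in `s`; for a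
piecewise smooth curve the velocity is undefined only at finitely many parameters of each compact
interval, and these do not contribute. -/
def length (γ : ℝ → M) (s : Set ℝ) : ℝ≥0∞ :=
  ∫⁻ t in s, ENNReal.ofReal
    (Real.sqrt (-(S.g (γ t) (velocity n γ univ t) (velocity n γ univ t))))

/-- The Lorentzian distance: the supremum of the lengths of the future-directed causal curves from
`p` to `q`, and `0` if there are none. -/
def dist (p q : M) : ℝ≥0∞ :=
  ⨆ (γ : ℝ → M) (a : ℝ) (b : ℝ) (_ : S.CausalCurve γ a b ∧ γ a = p ∧ γ b = q),
    S.length γ (Icc a b)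

/-- The half-open parameter interval `[0, b)`, where `b = ⊤` is allowed. -/
def dom (b : EReal) : Set ℝ := {t : ℝ | 0 ≤ t ∧ (t : EReal) < b}

/-- `γ : [0, b) → M` is a future-directed timelike curve (piecewise smooth on each compact
subinterval). -/
def TimelikeCurveOn (γ : ℝ → M) (b : EReal) : Prop :=
  0 < b ∧ ∀ t ∈ dom b, 0 < t → S.TimelikeCurve γ 0 t

/-- `p` is a future end point of `γ : [0, b) → M`. -/
def IsFutureEndpoint (γ : ℝ → M) (b : EReal) (p : M) : Prop :=
  ∀ U ∈ 𝓝 p, ∃ t₀ ∈ dom b, ∀ t ∈ dom b, t₀ ≤ t → γ t ∈ U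

/-- A future-inextendible future-directed timelike curve `γ : [0, b) → M`. -/
def InextendibleTimelikeCurve (γ : ℝ → M) (b : EReal) : Prop :=
  S.TimelikeCurveOn γ b ∧ ∀ p, ¬ IsFutureEndpoint γ b p

/-- A future-directed timelike ray `γ : [0, b) → M`: a future-inextendible timelike curve with past
end point `γ 0` every segment of which realizes the Lorentzian distance of its end points. -/
def TimelikeRay (γ : ℝ → M) (b : EReal) : Prop :=
  S.InextendibleTimelikeCurve γ b ∧
    ∀ s ∈ dom b, ∀ t ∈ dom b, s < t → S.length γ (Icc s t) = S.dist (γ s) (γ t)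

/-- `δ : [0, b) → M` is an affinely parametrized future-directed timelike geodesic. In each chart
its coordinate expression `c` solves the geodesic equation, which is written with the Christoffel
symbols of the first kind, `Γ_{k,ij} = (∂_i g_jk + ∂_j g_ik - ∂_k g_ij) / 2`:
`(g_kl c''^l + Γ_{k,ij} c'^i c'^j) w^k = 0` for all `w`. -/
def TimelikeGeodesic (δ : ℝ → M) (b : EReal) : Prop :=
  0 < b ∧ ContMDiffOn 𝓘(ℝ, ℝ) (𝓡 n) ∞ δ (dom b) ∧
  (∀ t ∈ dom b, S.FutureTimelike (velocity n δ (dom b) t)) ∧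
  ∀ t ∈ dom b, 0 < t → ∀ x₀ : M, δ t ∈ (extChartAt (𝓡 n) x₀).source →
    let G := chartMetric S.g x₀
    let c : ℝ → EuclideanSpace ℝ (Fin n) := fun s => extChartAt (𝓡 n) x₀ (δ s)
    ∀ w : EuclideanSpace ℝ (Fin n),
      G (c t) (deriv (deriv c) t) w + fderiv ℝ G (c t) (deriv c t) (deriv c t) w
        - (1 / 2 : ℝ) * fderiv ℝ G (c t) w (deriv c t) (deriv c t) = 0

/-- A future-directed timelike geodesic `δ : [0, b) → M` is future incomplete if it cannot be
extended to a geodesic that is defined for all affine parameters in `[0, ∞)`. -/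
def FutureIncomplete (δ : ℝ → M) (b : EReal) : Prop :=
  ¬ ∃ δ' : ℝ → M, S.TimelikeGeodesic δ' ⊤ ∧ ∀ t ∈ dom b, δ' t = δ t

/-- A past set: `I⁻(A) = A`. -/
def IsPastSet (A : Set M) : Prop := S.chronPast A = A

/-- An indecomposable past set: a non-empty past set that is not the union of two proper subsets
which are past sets. -/
def IsIndecomposablePastSet (W : Set M) : Prop :=
  W.Nonempty ∧ S.IsPastSet W ∧
    ¬ ∃ A B : Set M, S.IsPastSet A ∧ S.IsPastSet B ∧ A ⊂ W ∧ B ⊂ W ∧ A ∪ B = W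

/-- A terminal indecomposable past set: an indecomposable past set that is not the chronological
past of a point. -/
def IsTIP (W : Set M) : Prop :=
  S.IsIndecomposablePastSet W ∧ ∀ p : M, W ≠ S.chronPast {p}

/-- The chronological past `I⁻(γ)` of a future-inextendible timelike curve. -/
def IsPastOfInextendibleCurve (W : Set M) : Prop :=
  ∃ (γ : ℝ → M) (b : EReal), S.InextendibleTimelikeCurve γ b ∧ W = S.chronPast (γ '' dom b)

/-- No causal curve meets `U` in a disconnected set. -/
def CausallyConvex (U : Set M) : Prop :=
  ∀ (γ : ℝ → M) (a b : ℝ), S.CausalCurve γ a b → IsPreconnected (Icc a b ∩ γ ⁻¹' U)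

/-- Each point has arbitrarily small causally convex open neighbourhoods. -/
def StronglyCausal : Prop :=
  ∀ p : M, ∀ V ∈ 𝓝 p, ∃ U ⊆ V, IsOpen U ∧ p ∈ U ∧ S.CausallyConvex U

end Spacetime

end

/-!
Suppose that some timelike geodesic `η` is defined on `[0, ∞)`, and let `γ` be an incomplete timelike
ray. The geodesic has constant speed, as one sees by pairing the geodesic equation with the velocity
(`Spacetime.TimelikeGeodesic.hasDerivAt_energy`), so that it has infinite length. It also has no
future end point `p` (`Spacetime.TimelikeGeodesic.not_isFutureEndpoint`): near `p`, a fixed linear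
coordinate changes at a rate bounded away from zero along timelike curves of constant speed
(`exists_forall_near_lorentzian_form`), hence is unbounded on the geodesic.

So both `γ` and `η` are future-inextendible timelike curves, and the uniqueness of the TIP gives
`I⁻(γ) = I⁻(η)`. If uniqueness is meant for abstract terminal indecomposable past sets, one needs
that pasts of inextendible timelike curves are such sets under strong causality
(`Spacetime.InextendibleTimelikeCurve.isTIP`). Now `γ 0 ≪ η s` for some `s`, and every `η t` precedes
some `γ v`. A curve from `γ 0` to `η s`, along `η` to `η t`, and on to `γ v` shows that
`d(γ 0, γ v)` is at least the length of `η` on `[s, t]`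
(`Spacetime.TimelikeCurve.length_le_dist`), which is as large as one likes. But `γ` is a ray, so
`d(γ 0, γ v)` is the length of `γ` on `[0, v]` and is bounded by the finite length of `γ`.
-/

/-! ### Timelike curves and the chronology relation -/

namespace Spacetime

variable {n : ℕ} {M : Type*} [TopologicalSpace M] [ChartedSpace (EuclideanSpace ℝ (Fin n)) M]

theorem velocity_subset {γ : ℝ → M} {s u : Set ℝ} {t : ℝ} (hsu : s ⊆ u)
    (hs : UniqueDiffWithinAt ℝ s t) (h : MDifferentiableWithinAt 𝓘(ℝ, ℝ) (𝓡 n) γ u t) :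
    velocity n γ s t = velocity n γ u t := by
  unfold velocity
  rw [mfderivWithin_subset hsu hs.uniqueMDiffWithinAt h]

theorem velocity_of_mem_nhds {γ : ℝ → M} {s : Set ℝ} {t : ℝ} (h : s ∈ 𝓝 t) :
    velocity n γ s t = velocity n γ univ t := by
  unfold velocity
  rw [mfderivWithin_of_mem_nhds h, mfderivWithin_univ]

theorem velocity_add_const {γ : ℝ → M} {s : Set ℝ} {t d : ℝ}
    (hs : UniqueDiffWithinAt ℝ ((fun u => u + d) ⁻¹' s) t)
    (h : MDifferentiableWithinAt 𝓘(ℝ, ℝ) (𝓡 n) γ s (t + d)) :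
    velocity n (fun u => γ (u + d)) ((fun u => u + d) ⁻¹' s) t = velocity n γ s (t + d) := by
  unfold velocity
  have hadd : HasMFDerivWithinAt 𝓘(ℝ, ℝ) 𝓘(ℝ, ℝ) (fun u : ℝ => u + d)
      ((fun u => u + d) ⁻¹' s) t (ContinuousLinearMap.id ℝ ℝ) :=
    ((hasFDerivAt_id t).add_const d).hasFDerivWithinAt.hasMFDerivWithinAt
  have h2 := (h.hasMFDerivWithinAt.comp t hadd subset_rfl).mfderivWithin hs.uniqueMDiffWithinAt
  change mfderivWithin 𝓘(ℝ, ℝ) (𝓡 n) (γ ∘ fun u => u + d) _ t 1 = _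
  rw [h2]
  rfl

variable [IsManifold (𝓡 n) ∞ M] (S : Spacetime n M)

/-- Transport of being future timelike between equal base points: the vectors are compared in the
model space, of which every tangent space is a copy. -/
theorem futureTimelike_congr {x y : M} (h : x = y) {v : TangentSpace (𝓡 n) x}
    {w : TangentSpace (𝓡 n) y} (hvw : (show EuclideanSpace ℝ (Fin n) from v) = w)
    (hw : S.FutureTimelike w) : S.FutureTimelike v := by
  subst h
  change v = w at hvw
  rwa [hvw]

variable {S}

namespace TimelikeCurve

variable {γ γ₁ γ₂ : ℝ → M} {a b c : ℝ}

theorem lt (h : S.TimelikeCurve γ a b) : a < b := by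
  induction h with
  | piece h _ _ => exact h
  | concat _ _ h₁ h₂ => exact h₁.trans h₂

theorem continuousOn (h : S.TimelikeCurve γ a b) : ContinuousOn γ (Icc a b) := by
  induction h with
  | piece _ h _ => exact h.continuousOn
  | concat h₁ h₂ ih₁ ih₂ =>
    rw [← Icc_union_Icc_eq_Icc h₁.lt.le h₂.lt.le]
    exact ih₁.union_of_isClosed ih₂ isClosed_Icc isClosed_Icc

theorem causalCurve (h : S.TimelikeCurve γ a b) : S.CausalCurve γ a b := by
  induction h with
  | piece h hs ht => exact .piece h hs fun t ht' => ⟨(ht t ht').1.le, (ht t ht').2⟩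
  | concat _ _ h₁ h₂ => exact h₁.concat h₂

theorem congr (h : S.TimelikeCurve γ₁ a b) (he : EqOn γ₂ γ₁ (Icc a b)) :
    S.TimelikeCurve γ₂ a b := by
  induction h with
  | piece hab hs ht =>
    refine .piece hab (hs.congr he) fun t ht' => ?_
    refine futureTimelike_congr S (he ht') ?_ (ht t ht')
    unfold velocity
    rw [mfderivWithin_congr_of_mem he ht']
    rfl
  | concat h₁ h₂ ih₁ ih₂ =>
    exact (ih₁ (he.mono (Icc_subset_Icc_right h₂.lt.le))).concat
      (ih₂ (he.mono (Icc_subset_Icc_left h₁.lt.le)))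

theorem of_contMDiffOn {s : Set ℝ} (hγ : ContMDiffOn 𝓘(ℝ, ℝ) (𝓡 n) ∞ γ s)
    (ht : ∀ t ∈ s, S.FutureTimelike (velocity n γ s t)) (hab : a < b) (hs : Icc a b ⊆ s) :
    S.TimelikeCurve γ a b := by
  refine .piece hab (hγ.mono hs) fun t ht' => ?_
  rw [velocity_subset hs (uniqueDiffOn_Icc hab t ht')
    ((hγ t (hs ht')).mdifferentiableWithinAt (by simp))]
  exact ht t (hs ht')

theorem restrict (h : S.TimelikeCurve γ a b) {a' b' : ℝ} (ha : a ≤ a') (hab : a' < b')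
    (hb : b' ≤ b) : S.TimelikeCurve γ a' b' := by
  induction h generalizing a' b' with
  | piece _ hs ht => exact of_contMDiffOn hs ht hab (Icc_subset_Icc ha hb)
  | @concat a b c h₁ h₂ ih₁ ih₂ =>
    rcases le_total b' b with hb' | hb'
    · exact ih₁ ha hab hb'
    rcases le_total b a' with ha' | ha'
    · exact ih₂ ha' hab hb
    rcases hb'.eq_or_lt with rfl | hb'
    · exact ih₁ ha hab le_rfl
    rcases ha'.eq_or_lt with rfl | ha'
    · exact ih₂ le_rfl hab hb
    exact (ih₁ ha ha' le_rfl).concat (ih₂ le_rfl hb' hb)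

theorem translate (h : S.TimelikeCurve γ a b) (d : ℝ) :
    S.TimelikeCurve (fun t => γ (t + d)) (a - d) (b - d) := by
  induction h with
  | @piece a b hab hs ht =>
    have hab' : a - d < b - d := by linarith
    have hpre : (fun u : ℝ => u + d) ⁻¹' Icc a b = Icc (a - d) (b - d) := by simp
    refine .piece hab' ?_ fun t ht' => ?_
    · refine hs.comp (t := Icc a b) (g := γ) ?_ (fun t ht => by rwa [← hpre] at ht)
      exact (contDiff_id.add contDiff_const).contMDiff.contMDiffOn
    · have hmem : t + d ∈ Icc a b := by rwa [← hpre] at ht'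
      have hu := uniqueDiffOn_Icc hab' t ht'
      rw [← hpre] at hu ⊢
      rw [velocity_add_const hu ((hs _ hmem).mdifferentiableWithinAt (by simp))]
      exact ht _ hmem
  | concat _ _ ih₁ ih₂ => exact ih₁.concat ih₂

theorem glue (h₁ : S.TimelikeCurve γ₁ a b) (h₂ : S.TimelikeCurve γ₂ b c) (hb : γ₁ b = γ₂ b) :
    S.TimelikeCurve (fun t => if t ≤ b then γ₁ t else γ₂ t) a c := by
  refine (h₁.congr fun t ht => if_pos ht.2).concat (h₂.congr fun t ht => ?_)
  rcases ht.1.eq_or_lt with rfl | h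
  · simpa using hb
  · exact if_neg h.not_ge

end TimelikeCurve

theorem TimelikeCurve.chron {γ : ℝ → M} {a b : ℝ} (h : S.TimelikeCurve γ a b) :
    S.Chron (γ a) (γ b) := ⟨γ, a, b, h, rfl, rfl⟩

theorem Chron.exists_ending_at {p q : M} (h : S.Chron p q) (b : ℝ) :
    ∃ (γ : ℝ → M) (a : ℝ), S.TimelikeCurve γ a b ∧ γ a = p ∧ γ b = q := by
  obtain ⟨γ, a, c, h, rfl, rfl⟩ := h
  refine ⟨_, _, by simpa using h.translate (c - b), ?_, ?_⟩ <;> simp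

theorem Chron.exists_starting_at {p q : M} (h : S.Chron p q) (a : ℝ) :
    ∃ (γ : ℝ → M) (b : ℝ), S.TimelikeCurve γ a b ∧ γ a = p ∧ γ b = q := by
  obtain ⟨γ, c, b, h, rfl, rfl⟩ := h
  refine ⟨_, _, by simpa using h.translate (c - a), ?_, ?_⟩ <;> simp

theorem Chron.trans {p q r : M} (h₁ : S.Chron p q) (h₂ : S.Chron q r) : S.Chron p r := by
  obtain ⟨γ₁, a, b, h₁, rfl, rfl⟩ := h₁
  obtain ⟨γ₂, c, hγ₂, hb, rfl⟩ := h₂.exists_starting_at b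
  exact ⟨_, a, c, h₁.glue hγ₂ hb.symm, by simp [h₁.lt.le], by simp [hγ₂.lt.not_ge]⟩

/-! ### Pasts of timelike curves -/

theorem exists_gt_mem_dom {b : EReal} {t : ℝ} (ht : t ∈ dom b) : ∃ u ∈ dom b, t < u := by
  obtain ⟨u, h₁, h₂⟩ := EReal.lt_iff_exists_real_btwn.1 ht.2
  have h₁ := EReal.coe_lt_coe_iff.1 h₁
  exact ⟨u, ⟨ht.1.trans h₁.le, h₂⟩, h₁⟩

theorem zero_mem_dom {b : EReal} (hb : 0 < b) : (0 : ℝ) ∈ dom b := ⟨le_rfl, by simpa using hb⟩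

theorem Icc_subset_dom {b : EReal} {s t : ℝ} (hs : 0 ≤ s) (ht : t ∈ dom b) : Icc s t ⊆ dom b :=
  fun _ hu => ⟨hs.trans hu.1, (EReal.coe_le_coe_iff.2 hu.2).trans_lt ht.2⟩

theorem dom_top : dom ⊤ = Ici (0 : ℝ) := by
  ext t
  simp [dom, EReal.coe_lt_top]

namespace TimelikeCurveOn

variable {γ : ℝ → M} {b : EReal}

theorem timelikeCurve (h : S.TimelikeCurveOn γ b) {s t : ℝ} (hs : s ∈ dom b) (ht : t ∈ dom b)
    (hst : s < t) : S.TimelikeCurve γ s t :=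
  (h.2 t ht (hs.1.trans_lt hst)).restrict hs.1 hst le_rfl

theorem mem_chronPast (h : S.TimelikeCurveOn γ b) {t : ℝ} (ht : t ∈ dom b) :
    γ t ∈ S.chronPast (γ '' dom b) := by
  obtain ⟨u, hu, htu⟩ := exists_gt_mem_dom ht
  exact ⟨_, mem_image_of_mem γ hu, (h.timelikeCurve ht hu htu).chron⟩

/-- In a decomposition of the past of a curve, one of the parts contains points of the curve that are
later than any two given ones, and hence contains everything in their pasts. -/
theorem isIndecomposablePastSet (h : S.TimelikeCurveOn γ b) :
    S.IsIndecomposablePastSet (S.chronPast (γ '' dom b)) := by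
  refine ⟨⟨_, h.mem_chronPast (zero_mem_dom h.1)⟩, ?_, ?_⟩
  · apply Subset.antisymm
    · rintro p ⟨q, ⟨r, hr, hqr⟩, hpq⟩
      exact ⟨r, hr, hpq.trans hqr⟩
    · rintro p ⟨_, ⟨t, ht, rfl⟩, hp⟩
      exact ⟨_, h.mem_chronPast ht, hp⟩
  · rintro ⟨A, B, hA, hB, hAW, hBW, hAB⟩
    obtain ⟨x, ⟨_, ⟨s, hs, rfl⟩, hx⟩, hxA⟩ := exists_of_ssubset hAW
    obtain ⟨y, ⟨_, ⟨t, ht, rfl⟩, hy⟩, hyB⟩ := exists_of_ssubset hBW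
    obtain ⟨u, hu, hsu, htu⟩ : ∃ u ∈ dom b, s < u ∧ t < u := by
      rcases le_total s t with hst | hst
      · obtain ⟨u, hu, hlt⟩ := exists_gt_mem_dom ht
        exact ⟨u, hu, hst.trans_lt hlt, hlt⟩
      · obtain ⟨u, hu, hlt⟩ := exists_gt_mem_dom hs
        exact ⟨u, hu, hlt, hst.trans_lt hlt⟩
    rcases hAB ▸ h.mem_chronPast hu with huA | huB
    · exact hxA (hA ▸ ⟨_, huA, hx.trans (h.timelikeCurve hs hu hsu).chron⟩)
    · exact hyB (hB ▸ ⟨_, huB, hy.trans (h.timelikeCurve ht hu htu).chron⟩)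

/-- A chronological past of a timelike curve that is also the past of a point `p` forces the curve to
converge to `p`: from a point `q ≪ p` in a causally convex neighbourhood on, the curve is trapped
between `q` and `p`. -/
theorem isFutureEndpoint_of_chronPast_eq (h : S.TimelikeCurveOn γ b) (hS : S.StronglyCausal)
    {p : M} (hp : S.chronPast (γ '' dom b) = S.chronPast {p}) : IsFutureEndpoint γ b p := by
  intro V hV
  obtain ⟨U, hUV, hUo, hpU, hU⟩ := hS p V hV
  obtain ⟨q, hqU, hqp⟩ : ∃ q ∈ U, S.Chron q p := by
    have h₀ : γ 0 ∈ S.chronPast {p} := hp ▸ h.mem_chronPast (zero_mem_dom h.1)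
    obtain ⟨_, rfl, α, c, d, hα, -, rfl⟩ := h₀
    have hd := (hα.continuousOn d (right_mem_Icc.2 hα.lt.le)).mono Ioo_subset_Icc_self
    have : (𝓝[Ioo c d] d).NeBot := right_nhdsWithin_Ioo_neBot hα.lt
    obtain ⟨t, htU, ht⟩ := ((hd.eventually (hUo.mem_nhds hpU)).and self_mem_nhdsWithin).exists
    exact ⟨α t, htU, (hα.restrict ht.1.le ht.2 le_rfl).chron⟩
  obtain ⟨_, ⟨s, hs, rfl⟩, hqs⟩ : q ∈ S.chronPast (γ '' dom b) := hp ▸ ⟨p, rfl, hqp⟩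
  refine ⟨s, hs, fun t ht hst => hUV ?_⟩
  have hqt : S.Chron q (γ t) := by
    rcases hst.eq_or_lt with rfl | hst
    · exact hqs
    · exact hqs.trans (h.timelikeCurve hs ht hst).chron
  obtain ⟨_, rfl, htp⟩ : γ t ∈ S.chronPast {p} := hp ▸ h.mem_chronPast ht
  obtain ⟨α, c, hα, rfl, hαt⟩ := hqt.exists_ending_at 0
  obtain ⟨β, d, hβ, hβt, rfl⟩ := htp.exists_starting_at 0
  have hmem := (hU _ _ _ (hα.glue hβ (hαt.trans hβt.symm)).causalCurve).ordConnected.out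
    (x := c) (y := d) ⟨⟨le_rfl, (hα.lt.trans hβ.lt).le⟩, by simpa [hα.lt.le] using hqU⟩
    ⟨⟨(hα.lt.trans hβ.lt).le, le_rfl⟩, by simpa [hβ.lt.not_ge] using hpU⟩
    (show (0 : ℝ) ∈ Icc c d from ⟨hα.lt.le, hβ.lt.le⟩)
  simpa [hαt] using hmem.2

end TimelikeCurveOn

/-- The half of the Geroch–Kronheimer–Penrose theorem that is needed: in a strongly causal
spacetime, pasts of future-inextendible timelike curves are TIPs. -/
theorem InextendibleTimelikeCurve.isTIP {γ : ℝ → M} {b : EReal}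
    (h : S.InextendibleTimelikeCurve γ b) (hS : S.StronglyCausal) :
    S.IsTIP (S.chronPast (γ '' dom b)) :=
  ⟨h.1.isIndecomposablePastSet, fun p hp => h.2 p (h.1.isFutureEndpoint_of_chronPast_eq hS hp)⟩

end Spacetime

/-! ### The metric along a curve in a chart -/

namespace Spacetime

variable {n : ℕ} {M : Type*} [TopologicalSpace M] [ChartedSpace (EuclideanSpace ℝ (Fin n)) M]
  [IsManifold (𝓡 n) ∞ M] {S : Spacetime n M}

/-- The chart representation computes the metric on the velocity of a curve. -/
theorem chartMetric_deriv {δ : ℝ → M} {t : ℝ} {x₀ : M}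
    (g : ∀ x : M, TangentSpace (𝓡 n) x →L[ℝ] TangentSpace (𝓡 n) x →L[ℝ] ℝ)
    (hδ : MDifferentiableAt 𝓘(ℝ, ℝ) (𝓡 n) δ t) (hx : δ t ∈ (extChartAt (𝓡 n) x₀).source) :
    chartMetric g x₀ (extChartAt (𝓡 n) x₀ (δ t)) (deriv (fun s => extChartAt (𝓡 n) x₀ (δ s)) t)
      (deriv (fun s => extChartAt (𝓡 n) x₀ (δ s)) t) =
    g (δ t) (velocity n δ univ t) (velocity n δ univ t) := by
  set φ := extChartAt (𝓡 n) x₀ with hφ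
  have hsymm : MDifferentiableAt 𝓘(ℝ, EuclideanSpace ℝ (Fin n)) (𝓡 n) φ.symm (φ (δ t)) := by
    have h := mdifferentiableWithinAt_extChartAt_symm (I := 𝓡 n) (φ.map_source hx)
    rwa [ModelWithCorners.range_eq_univ, mdifferentiableWithinAt_univ] at h
  have hc : MDifferentiableAt 𝓘(ℝ, ℝ) 𝓘(ℝ, EuclideanSpace ℝ (Fin n)) (fun s => φ (δ s)) t :=
    (mdifferentiableAt_extChartAt (by simpa [hφ] using hx)).comp t hδ
  have heq : φ.symm ∘ (fun s => φ (δ s)) =ᶠ[𝓝 t] δ := by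
    filter_upwards [hδ.continuousAt.eventually ((isOpen_extChartAt_source x₀).mem_nhds hx)]
      with s hs using φ.left_inv hs
  have hvel : velocity n δ univ t = (show EuclideanSpace ℝ (Fin n) from
      mfderiv 𝓘(ℝ, EuclideanSpace ℝ (Fin n)) (𝓡 n) φ.symm (φ (δ t))
        (deriv (fun s => φ (δ s)) t)) := by
    unfold velocity
    rw [mfderivWithin_univ, ← heq.mfderiv_eq, mfderiv_comp t hsymm hc, mfderiv_eq_fderiv]
    rfl
  -- The tangent space depends on the point, so that points and vectors are replaced together.
  have key : ∀ y : M, y = δ t → ∀ v : EuclideanSpace ℝ (Fin n),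
      v = (velocity n δ univ t : EuclideanSpace ℝ (Fin n)) →
      (g y : EuclideanSpace ℝ (Fin n) →L[ℝ] EuclideanSpace ℝ (Fin n) →L[ℝ] ℝ) v v =
      g (δ t) (velocity n δ univ t) (velocity n δ univ t) := by
    rintro _ rfl _ rfl
    rfl
  exact key _ (φ.left_inv hx) _ hvel.symm

theorem chartMetric_symm (x₀ : M) (y v w : EuclideanSpace ℝ (Fin n)) :
    chartMetric S.g x₀ y v w = chartMetric S.g x₀ y w v :=
  S.symm _ _ _

theorem chartMetric_lorentzian (x₀ : M) {y : EuclideanSpace ℝ (Fin n)}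
    (hy : y ∈ (extChartAt (𝓡 n) x₀).target) :
    ∃ v, chartMetric S.g x₀ y v v < 0 ∧
      ∀ w, chartMetric S.g x₀ y v w = 0 → w ≠ 0 → 0 < chartMetric S.g x₀ y w w := by
  obtain ⟨A, hA⟩ : (mfderiv 𝓘(ℝ, EuclideanSpace ℝ (Fin n)) (𝓡 n)
      (extChartAt (𝓡 n) x₀).symm y).IsInvertible := by
    have := isInvertible_mfderivWithin_extChartAt_symm (I := 𝓡 n) hy
    rwa [ModelWithCorners.range_eq_univ, mfderivWithin_univ] at this
  have hG : ∀ v w, chartMetric S.g x₀ y v w = S.g ((extChartAt (𝓡 n) x₀).symm y) (A v) (A w) := by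
    intro v w
    unfold chartMetric
    rw [← hA]
    rfl
  obtain ⟨v, hv, hvw⟩ := S.lorentzian ((extChartAt (𝓡 n) x₀).symm y)
  obtain ⟨v, rfl⟩ := A.surjective v
  exact ⟨v, (hG v v).trans_lt hv, fun w hw hw0 => (hvw (A w) ((hG v w).symm.trans hw)
    fun h => hw0 (A.injective (h.trans (map_zero A).symm))).trans_eq (hG w w).symm⟩

theorem contDiffAt_chartMetric (x₀ : M) {y : EuclideanSpace ℝ (Fin n)}
    (hy : y ∈ (extChartAt (𝓡 n) x₀).target) : ContDiffAt ℝ ∞ (chartMetric S.g x₀) y :=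
  (S.smooth x₀).contDiffAt ((isOpen_extChartAt_target x₀).mem_nhds hy)

end Spacetime

/-! ### Bilinear forms on a normed space -/

/-- Solutions of the geodesic equation have constant energy: pair the equation with the velocity. -/
theorem hasDerivAt_geodesic_energy {E : Type*} [NormedAddCommGroup E] [NormedSpace ℝ E]
    {G : E → E →L[ℝ] E →L[ℝ] ℝ} {c : ℝ → E} {t : ℝ} (hG : DifferentiableAt ℝ G (c t))
    (hc : ContDiffAt ℝ ∞ c t) (hsymm : ∀ v w, G (c t) v w = G (c t) w v)
    (hgeo : ∀ w, G (c t) (deriv (deriv c) t) w + fderiv ℝ G (c t) (deriv c t) (deriv c t) w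
      - (1 / 2 : ℝ) * fderiv ℝ G (c t) w (deriv c t) (deriv c t) = 0) :
    HasDerivAt (fun s => G (c s) (deriv c s) (deriv c s)) 0 t := by
  have hc₁ : HasDerivAt c (deriv c t) t := (hc.differentiableAt (by simp)).hasDerivAt
  have hc₂ : HasDerivAt (deriv c) (deriv (deriv c) t) t :=
    (((hc.fderiv_right (m := 1) (by norm_cast)).differentiableAt one_ne_zero).clm_apply
      (differentiableAt_const (1 : ℝ))).hasDerivAt
  have hGc : HasDerivAt (fun s => G (c s)) (fderiv ℝ G (c t) (deriv c t)) t :=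
    HasFDerivAt.comp_hasDerivAt (E := E →L[ℝ] E →L[ℝ] ℝ) t (l := G) (l' := fderiv ℝ G (c t))
      hG.hasFDerivAt hc₁
  have hGc₁ := hGc.clm_apply hc₂
  have hGc₂ := hGc₁.clm_apply hc₂
  have h := hgeo (deriv c t)
  have h' := hsymm (deriv c t) (deriv (deriv c) t)
  have hzero : (fderiv ℝ G (c t) (deriv c t) (deriv c t) + G (c t) (deriv (deriv c) t)) (deriv c t)
      + G (c t) (deriv c t) (deriv (deriv c) t) = 0 := by
    rw [add_apply]
    linarith
  rwa [hzero] at hGc₂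

/-- If a symmetric bilinear form is negative on `u` and positive definite on the orthogonal
complement of `u`, then for all forms `B` near it the component along `u` of a `B`-timelike vector
is bounded below by the `B`-length of the vector. -/
theorem exists_forall_near_lorentzian_form {E : Type*} [NormedAddCommGroup E] [NormedSpace ℝ E]
    [FiniteDimensional ℝ E] (G : E →L[ℝ] E →L[ℝ] ℝ) (hsymm : ∀ v w, G v w = G w v) {u : E}
    (hu : G u u < 0) (hpos : ∀ w, G u w = 0 → w ≠ 0 → 0 < G w w) :
    ∃ C > 0, ∃ ε > 0, ∀ B : E →L[ℝ] E →L[ℝ] ℝ, ‖B - G‖ ≤ ε → ∀ v, -B v v ≤ C * (G u v) ^ 2 := by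
  -- With `C = 1 / -G u u` the form `G v v + C (G u v)²` would only be semidefinite.
  set C : ℝ := 2 / -G u u with hC
  have hC0 : 0 < C := div_pos two_pos (neg_pos.2 hu)
  -- Reversing the sign along `u` makes the form positive definite.
  have hdef : ∀ v, v ≠ 0 → 0 < G v v + C * (G u v) ^ 2 := by
    intro v hv
    obtain ⟨a, ha⟩ : ∃ a, a * G u u = G u v := ⟨G u v / G u u, div_mul_cancel₀ _ hu.ne⟩
    have hw : G u (v - a • u) = 0 := by simp [ha]
    have hvv : G v v + C * (G u v) ^ 2 = G (v - a • u) (v - a • u) + -G u u * a ^ 2 := by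
      have h₁ : C * (G u v) ^ 2 = -(2 * a ^ 2 * G u u) := by
        rw [hC, ← ha]
        field_simp [hu.ne]
      have h₂ : G (v - a • u) (v - a • u) = G v v - 2 * a * G u v + a ^ 2 * G u u := by
        simp [hsymm v u]
        ring
      rw [h₁, h₂, ← ha]
      ring
    rw [hvv]
    by_cases hvu : v - a • u = 0
    · have ha0 : a ≠ 0 := by
        rintro rfl
        exact hv (by simpa using hvu)
      have := mul_pos (neg_pos.2 hu) (pow_pos (abs_pos.2 ha0) 2)
      rw [sq_abs] at this
      simpa [hvu] using this
    · have := hpos _ hw hvu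
      have := mul_nonneg (neg_pos.2 hu).le (sq_nonneg a)
      linarith
  have hu0 : u ≠ 0 := by
    rintro rfl
    simp at hu
  obtain ⟨z, hz, hmin⟩ := (isCompact_sphere (0 : E) 1).exists_isMinOn
    ⟨‖u‖⁻¹ • u, by simp [norm_smul, hu0]⟩
    (show Continuous fun v => G v v + C * (G u v) ^ 2 by fun_prop).continuousOn
  have hz1 : ‖z‖ = 1 := by simpa using hz
  refine ⟨C, hC0, _, hdef z (norm_pos_iff.1 (by simp [hz1])), fun B hB v => ?_⟩
  set ε := G z z + C * (G u z) ^ 2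
  have hGv : ε * ‖v‖ ^ 2 ≤ G v v + C * (G u v) ^ 2 := by
    by_cases hv : v = 0
    · simp [hv]
    have hv' : ‖v‖ ≠ 0 := norm_ne_zero_iff.2 hv
    have h : ε ≤ _ := hmin (show ‖v‖⁻¹ • v ∈ Metric.sphere (0 : E) 1 by simp [norm_smul, hv])
    simp only [map_smul, smul_apply, smul_eq_mul] at h
    have h' := mul_le_mul_of_nonneg_right h (sq_nonneg ‖v‖)
    refine h'.trans (le_of_eq ?_)
    field_simp
  have hBv : |(B - G) v v| ≤ ε * ‖v‖ ^ 2 := by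
    rw [← Real.norm_eq_abs, sq, ← mul_assoc]
    exact ((B - G).le_opNorm₂ v v).trans (by gcongr)
  have := (abs_le.1 hBv).1
  simp only [sub_apply] at this
  linarith

/-! ### Complete timelike geodesics -/

namespace Spacetime

variable {n : ℕ} {M : Type*} [TopologicalSpace M] [ChartedSpace (EuclideanSpace ℝ (Fin n)) M]
  [IsManifold (𝓡 n) ∞ M] {S : Spacetime n M}

theorem contDiffAt_extChartAt_comp {δ : ℝ → M} {t : ℝ} {x₀ : M}
    (hδ : ContMDiffAt 𝓘(ℝ, ℝ) (𝓡 n) ∞ δ t) (hx : δ t ∈ (extChartAt (𝓡 n) x₀).source) :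
    ContDiffAt ℝ ∞ (fun s => extChartAt (𝓡 n) x₀ (δ s)) t :=
  ((contMDiffAt_extChartAt' (by simpa using hx)).comp t hδ).contDiffAt

/-- `g(v, v)` for the velocity `v` at `t` of the curve `δ`. -/
noncomputable def energy (S : Spacetime n M) (δ : ℝ → M) (t : ℝ) : ℝ :=
  S.g (δ t) (velocity n δ univ t) (velocity n δ univ t)

namespace TimelikeGeodesic

variable {δ : ℝ → M}

theorem contMDiffAt (h : S.TimelikeGeodesic δ ⊤) {t : ℝ} (ht : 0 < t) :
    ContMDiffAt 𝓘(ℝ, ℝ) (𝓡 n) ∞ δ t :=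
  h.2.1.contMDiffAt (by rw [dom_top]; exact Ici_mem_nhds ht)

theorem energy_neg (h : S.TimelikeGeodesic δ ⊤) {t : ℝ} (ht : 0 < t) : S.energy δ t < 0 := by
  have hd : dom ⊤ ∈ 𝓝 t := by rw [dom_top]; exact Ici_mem_nhds ht
  have := (h.2.2.1 t (mem_of_mem_nhds hd)).1
  rwa [velocity_of_mem_nhds hd] at this

theorem timelikeCurve (h : S.TimelikeGeodesic δ ⊤) {s t : ℝ} (hs : 0 ≤ s) (hst : s < t) :
    S.TimelikeCurve δ s t :=
  TimelikeCurve.of_contMDiffOn h.2.1 h.2.2.1 hst fun u hu => by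
    rw [dom_top]
    exact hs.trans hu.1

theorem hasDerivAt_energy (h : S.TimelikeGeodesic δ ⊤) {t : ℝ} (ht : 0 < t) :
    HasDerivAt (S.energy δ) 0 t := by
  have htd : t ∈ dom ⊤ := by rw [dom_top]; exact ht.le
  have hx : δ t ∈ (extChartAt (𝓡 n) (δ t)).source := mem_extChartAt_source (δ t)
  have hc := contDiffAt_extChartAt_comp (h.contMDiffAt ht) hx
  have hd := hasDerivAt_geodesic_energy
    ((contDiffAt_chartMetric (S := S) (δ t) (mem_extChartAt_target (δ t))).differentiableAt
      (by simp)) hc (chartMetric_symm (δ t) _) (h.2.2.2 t htd ht (δ t) hx)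
  refine hd.congr_of_eventuallyEq ?_
  filter_upwards [(h.contMDiffAt ht).continuousAt.eventually
    ((isOpen_extChartAt_source (δ t)).mem_nhds hx), Ioi_mem_nhds ht] with s hs hs'
  exact (chartMetric_deriv S.g ((h.contMDiffAt hs').mdifferentiableAt (by simp)) hs).symm

theorem exists_energy_eq (h : S.TimelikeGeodesic δ ⊤) :
    ∃ k > 0, ∀ t, 0 < t → S.energy δ t = -k := by
  refine ⟨-S.energy δ 1, neg_pos.2 (h.energy_neg one_pos), fun t ht => ?_⟩
  rw [neg_neg]
  exact isOpen_Ioi.is_const_of_deriv_eq_zero isPreconnected_Ioi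
    (fun s hs => (h.hasDerivAt_energy hs).differentiableAt.differentiableWithinAt)
    (fun s hs => (h.hasDerivAt_energy hs).deriv) ht (mem_Ioi.2 one_pos)

/-- In a chart around a hypothetical end point, one coordinate of the geodesic has a derivative that
is bounded away from zero, so that it is unbounded. -/
theorem not_isFutureEndpoint (h : S.TimelikeGeodesic δ ⊤) (p : M) :
    ¬ IsFutureEndpoint δ ⊤ p := by
  intro hp
  obtain ⟨k, hk, hkδ⟩ := h.exists_energy_eq
  set φ := extChartAt (𝓡 n) p
  have hpφ : p ∈ φ.source := mem_extChartAt_source p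
  have hy : φ p ∈ φ.target := φ.map_source hpφ
  obtain ⟨u, hu, hpos⟩ := chartMetric_lorentzian (S := S) p hy
  obtain ⟨C, hC, ε, hε, hB⟩ := exists_forall_near_lorentzian_form (chartMetric S.g p (φ p))
    (chartMetric_symm p _) hu hpos
  set ℓ := chartMetric S.g p (φ p) u
  have hφc : ContinuousAt φ p := continuousAt_extChartAt p
  have hGc : ContinuousAt (fun x => chartMetric S.g p (φ x)) p :=
    ContinuousAt.comp (g := chartMetric S.g p) (contDiffAt_chartMetric p hy).continuousAt hφc
  have hGε : ∀ᶠ x in 𝓝 p, ‖chartMetric S.g p (φ x) - chartMetric S.g p (φ p)‖ < ε :=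
    hGc.eventually (eventually_norm_sub_lt
      (E := EuclideanSpace ℝ (Fin n) →L[ℝ] EuclideanSpace ℝ (Fin n) →L[ℝ] ℝ) _ hε)
  have hℓc : ContinuousAt (fun x => ℓ (φ x)) p := ℓ.continuous.continuousAt.comp hφc
  have hU : {x | x ∈ φ.source ∧ ‖chartMetric S.g p (φ x) - chartMetric S.g p (φ p)‖ < ε ∧
      ℓ (φ x) ∈ Metric.ball (ℓ (φ p)) 1} ∈ 𝓝 p :=
    Filter.inter_mem ((isOpen_extChartAt_source p).mem_nhds hpφ)
      (Filter.inter_mem hGε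
        (hℓc.eventually (Metric.ball_mem_nhds _ one_pos)))
  obtain ⟨t₀, ht₀, hδU⟩ := hp _ hU
  rw [dom_top] at ht₀
  simp only [dom_top] at hδU
  have hpos' : ∀ t, t₀ + 1 ≤ t → 0 < t := fun t ht => by
    have : (0 : ℝ) ≤ t₀ := ht₀
    linarith
  have hU' : ∀ t, t₀ + 1 ≤ t → δ t ∈ φ.source ∧
      ‖chartMetric S.g p (φ (δ t)) - chartMetric S.g p (φ p)‖ < ε ∧
      ℓ (φ (δ t)) ∈ Metric.ball (ℓ (φ p)) 1 := fun t ht => hδU t (hpos' t ht).le (by linarith)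
  have hderiv : ∀ t, t₀ + 1 ≤ t → HasDerivAt (fun s => ℓ (φ (δ s)))
      (ℓ (deriv (fun s => φ (δ s)) t)) t := fun t ht =>
    ℓ.hasFDerivAt.comp_hasDerivAt t ((contDiffAt_extChartAt_comp (h.contMDiffAt (hpos' t ht))
      (hU' t ht).1).differentiableAt (by simp)).hasDerivAt
  have hlow : ∀ t, t₀ + 1 ≤ t → k ≤ C * (ℓ (deriv (fun s => φ (δ s)) t)) ^ 2 := by
    intro t ht
    refine le_trans ?_ (hB _ (hU' t ht).2.1.le _)
    rw [chartMetric_deriv S.g ((h.contMDiffAt (hpos' t ht)).mdifferentiableAt (by simp))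
      (hU' t ht).1]
    have := hkδ t (hpos' t ht)
    unfold energy at this
    linarith
  -- On a parameter interval of length `r` with `k r² > 4 C` the coordinate would vary by over `2`.
  obtain ⟨r, hr, hkr⟩ : ∃ r > 0, 4 * C < k * r ^ 2 := by
    have h4 : 0 < 4 * C / k + 1 := by positivity
    refine ⟨Real.sqrt (4 * C / k + 1), Real.sqrt_pos.2 h4, ?_⟩
    rw [Real.sq_sqrt h4.le]
    field_simp
    linarith
  obtain ⟨ξ, hξ, hξ'⟩ := exists_hasDerivAt_eq_slope (fun s => ℓ (φ (δ s)))
    (fun t => ℓ (deriv (fun s => φ (δ s)) t)) (show t₀ + 1 < t₀ + 1 + r by linarith)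
    (fun t ht => (hderiv t ht.1).continuousAt.continuousWithinAt)
    (fun t ht => hderiv t ht.1.le)
  have h₁ := (hU' (t₀ + 1) le_rfl).2.2
  have h₂ := (hU' (t₀ + 1 + r) (by linarith)).2.2
  have h₃ := hlow ξ hξ.1.le
  rw [Real.ball_eq_Ioo] at h₁ h₂
  rw [add_sub_cancel_left, eq_div_iff hr.ne'] at hξ'
  have h₄ : (ℓ (deriv (fun s => φ (δ s)) ξ) * r) ^ 2 ≤ 2 ^ 2 := by
    rw [hξ']
    refine sq_le_sq' ?_ ?_ <;> linarith [h₁.1, h₁.2, h₂.1, h₂.2]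
  have h₅ := mul_le_mul_of_nonneg_right h₃ (sq_nonneg r)
  nlinarith

theorem inextendibleTimelikeCurve (h : S.TimelikeGeodesic δ ⊤) :
    S.InextendibleTimelikeCurve δ ⊤ :=
  ⟨⟨h.1, fun _ _ ht => h.timelikeCurve le_rfl ht⟩, h.not_isFutureEndpoint⟩

end TimelikeGeodesic

/-! ### Length and distance -/

theorem length_congr {γ₁ γ₂ : ℝ → M} {s : Set ℝ} (hs : IsOpen s) (h : EqOn γ₁ γ₂ s) :
    S.length γ₁ s = S.length γ₂ s := by
  refine setLIntegral_congr_fun hs.measurableSet fun t ht => ?_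
  have hx := h ht
  have hv : (velocity n γ₁ univ t : EuclideanSpace ℝ (Fin n)) = velocity n γ₂ univ t := by
    unfold velocity
    rw [mfderivWithin_univ, mfderivWithin_univ,
      (h.eventuallyEq_of_mem (hs.mem_nhds ht)).mfderiv_eq]
    rfl
  have key : ∀ (x y : M) (_ : x = y) (v w : EuclideanSpace ℝ (Fin n)) (_ : v = w),
      (S.g x : EuclideanSpace ℝ (Fin n) →L[ℝ] EuclideanSpace ℝ (Fin n) →L[ℝ] ℝ) v v =
      (S.g y : EuclideanSpace ℝ (Fin n) →L[ℝ] EuclideanSpace ℝ (Fin n) →L[ℝ] ℝ) w w := by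
    rintro x _ rfl v _ rfl
    rfl
  exact congrArg (fun r => ENNReal.ofReal (Real.sqrt (-r))) (key _ _ hx _ _ hv)

theorem length_mono (γ : ℝ → M) {s t : Set ℝ} (h : s ⊆ t) : S.length γ s ≤ S.length γ t :=
  lintegral_mono_set h

/-- Concatenating timelike curves from `p` to `γ a` and from `γ b` to `q` with `γ` between them gives
a curve from `p` to `q` that is at least as long as `γ`. -/
theorem TimelikeCurve.length_le_dist {γ : ℝ → M} {a b : ℝ} {p q : M} (h : S.TimelikeCurve γ a b)
    (hp : S.Chron p (γ a)) (hq : S.Chron (γ b) q) : S.length γ (Ioo a b) ≤ S.dist p q := by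
  obtain ⟨α, a', hα, rfl, hαa⟩ := hp.exists_ending_at a
  obtain ⟨β, b', hβ, hβb, rfl⟩ := hq.exists_starting_at b
  have h₁ := hα.glue h hαa
  have h₂ := h₁.glue hβ (by simp [h.lt.not_ge, hβb])
  calc S.length γ (Ioo a b) = S.length _ (Ioo a b) :=
        length_congr isOpen_Ioo fun t ht => by simp [ht.1.not_ge, ht.2.le]
    _ ≤ S.length _ (Icc a' b') :=
        length_mono _ (Ioo_subset_Icc_self.trans (Icc_subset_Icc hα.lt.le hβ.lt.le))
    _ ≤ S.dist _ _ := le_iSup_of_le _ <| le_iSup_of_le a' <| le_iSup_of_le b' <|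
        le_iSup_of_le ⟨h₂.causalCurve, by simp [hα.lt.le, h₁.lt.le], by simp [hβ.lt.not_ge]⟩ le_rfl

/-- A complete timelike geodesic has segments of arbitrarily large length from any parameter on. -/
theorem TimelikeGeodesic.exists_lt_length {δ : ℝ → M} (h : S.TimelikeGeodesic δ ⊤) {s : ℝ}
    (hs : 0 ≤ s) {L : ℝ≥0∞} (hL : L < ⊤) : ∃ t, s < t ∧ L < S.length δ (Ioo s t) := by
  obtain ⟨k, hk, hkδ⟩ := h.exists_energy_eq
  have hlen : ∀ t, S.length δ (Ioo s t) =
      ENNReal.ofReal (Real.sqrt k) * ENNReal.ofReal (t - s) := by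
    intro t
    rw [← Real.volume_Ioo, ← setLIntegral_const]
    refine setLIntegral_congr_fun measurableSet_Ioo fun u hu => ?_
    have := hkδ u (hs.trans_lt hu.1)
    unfold energy at this
    simp only [this, neg_neg]
  have hk' := Real.sqrt_pos.2 hk
  have hL0 : 0 < (L.toReal + 1) / Real.sqrt k := by positivity
  refine ⟨s + (L.toReal + 1) / Real.sqrt k, by linarith, ?_⟩
  rw [hlen, ← ENNReal.ofReal_mul hk'.le, add_sub_cancel_left, mul_div_cancel₀ _ hk'.ne',
    ENNReal.lt_ofReal_iff_toReal_lt hL.ne]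
  linarith

end Spacetime

/-! ### Incompleteness -/

theorem proposition3p1 {n : ℕ} {M : Type*} [TopologicalSpace M] [T2Space M]
    [SecondCountableTopology M] [ConnectedSpace M]
    [ChartedSpace (EuclideanSpace ℝ (Fin n)) M] [IsManifold (𝓡 n) ∞ M] (S : Spacetime n M)
    (hchron : S.Chronological)
    (hTIP : (∃! W : Set M, S.IsPastOfInextendibleCurve W) ∨
      (S.StronglyCausal ∧ ∃! W : Set M, S.IsTIP W))
    (hray : ∃ (γ : ℝ → M) (a : EReal),
      S.TimelikeRay γ a ∧ S.length γ (Spacetime.dom a) < ⊤)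
    (δ : ℝ → M) (b : EReal) (hδ : S.TimelikeGeodesic δ b) :
    S.FutureIncomplete δ b := by
  rintro ⟨η, hη, -⟩
  obtain ⟨γ, a, ⟨hγ, hmax⟩, hlen⟩ := hray
  have hηi := hη.inextendibleTimelikeCurve
  have hpast : S.chronPast (γ '' Spacetime.dom a) = S.chronPast (η '' Spacetime.dom ⊤) := by
    rcases hTIP with h | ⟨hS, h⟩
    · exact h.unique ⟨γ, a, hγ, rfl⟩ ⟨η, ⊤, hηi, rfl⟩
    · exact h.unique (hγ.isTIP hS) (hηi.isTIP hS)
  have h0 := Spacetime.zero_mem_dom hγ.1.1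
  obtain ⟨_, ⟨s, hs, rfl⟩, hγη⟩ := hpast ▸ hγ.1.mem_chronPast h0
  rw [Spacetime.dom_top] at hs
  obtain ⟨t, hst, ht⟩ := hη.exists_lt_length hs hlen
  have htd : t ∈ Spacetime.dom ⊤ := by
    rw [Spacetime.dom_top]
    exact (show 0 ≤ s from hs).trans hst.le
  obtain ⟨_, ⟨u, hu, rfl⟩, hηγ⟩ := hpast.symm ▸ hηi.1.mem_chronPast htd
  -- The end point is moved up the ray so that its parameter is positive.
  obtain ⟨v, hv, huv⟩ := Spacetime.exists_gt_mem_dom hu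
  have hle := (hη.timelikeCurve hs hst).length_le_dist hγη
    (hηγ.trans (hγ.1.timelikeCurve hu hv huv).chron)
  rw [← hmax 0 h0 v hv (hu.1.trans_lt huv)] at hle
  exact (ht.trans_le hle).not_ge (Spacetime.length_mono γ (Spacetime.Icc_subset_dom le_rfl hv))
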